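/- Let $N\ge 0$ and let $P,Q\subset\mathbb{R}^N$ be Lebesgue measurable sets of finite measure, $m(P)<\infty$ and $m(Q)<\infty$, whose boundaries have Lebesgue measure zero. For $f\in L^2(\mathbb{R}^N)$ (complex valued) write $\mathcal{F}f(u)=\int_{\mathbb{R}^N}f(x)e^{-i x\cdot u}\,dx$ for its Fourier transform (extended to $L^2$ by continuity). For a measurable set $S$, let $\mathcal{T}_S$ be the orthogonal projection of $L^2(\mathbb{R}^N)$ onto $\{f: f(x)=0 \text{ for a.e. } x\notin S\}$, and let $\mathcal{B}_S$ be the orthogonal projection onto $\{f:\mathcal{F}f(u)=0\text{ for a.e. }u\notin S\}$. For a real $N\times N$ matrix $A$ write $AP=\{Ax:x\in P\}$. Let $A=A(\tau)$ and $B=B(\rho)$ be real $N\times N$ matrices depending on parameters $\tau$ and $\rho$, and let $(\tau,\rho)\to(\tau_0,\rho_0)$ be a limit of the parameters: formally, a limit along an arbitrary filter on the set of pairs $(\tau,\rho)$, so that for real parameters $\tau_0,\rho_0$ may be finite or infinite, and constant matrices and matrices depending on several parameters are included. Let $U$ be the unit ball of $\mathbb{R}^N$ and suppose that $$\lim_{(\tau,\rho)\to(\tau_0,\rho_0)}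 B^{T}A\,U=\mathbb{R}^N ,$$ that is, every $x\in\mathbb{R}^N$ belongs to $B^TAU$ for all $(\tau,\rho)$ sufficiently close to the limit (so that $A$ and $B$ are then invertible). For every $0<\varepsilon<1$, let $N_{A,B}(\varepsilon)$ be the number of eigenvalues, counted with multiplicity, of $\mathcal{T}_{AP}\mathcal{B}_{BQ}\mathcal{T}_{AP}$ that are not smaller than $\varepsilon$. Then $$\lim_{(\tau,\rho)\to(\tau_0,\rho_0)}\frac{N_{A,B}(\varepsilon)}{|\det A|\,|\det B|}=(2\pi)^{-N}\,m(P)\,m(Q).$$ -/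

import Mathlib

open MeasureTheory Filter Topology
open scoped ENNReal FourierTransform

noncomputable section

/-- The complex Hilbert space `L²(ℝᴺ)`, with `ℝᴺ` the Euclidean space. -/
abbrev L2Space (N : ℕ) : Type :=
  Lp ℂ 2 (volume : Measure (EuclideanSpace ℝ (Fin N)))

/-- The subspace of all `f ∈ L²(ℝᴺ)` with `f x = 0` for (almost every) `x ∉ P`. -/
def spaceLimited {N : ℕ} (P : Set (EuclideanSpace ℝ (Fin N))) : Submodule ℂ (L2Space N) where
  carrier := {f | ∀ᵐ x, x ∉ P → f x = 0}
  zero_mem' := by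
    filter_upwards [Lp.coeFn_zero ℂ 2 (volume : Measure (EuclideanSpace ℝ (Fin N)))] with x hx _
    rw [hx]; rfl
  add_mem' := by
    intro f g hf hg
    filter_upwards [hf, hg, Lp.coeFn_add f g] with x h1 h2 h3 hx
    rw [h3, Pi.add_apply, h1 hx, h2 hx, add_zero]
  smul_mem' := by
    intro c f hf
    filter_upwards [hf, Lp.coeFn_smul c f] with x h1 h2 hx
    rw [h2, Pi.smul_apply, h1 hx, smul_zero]

theorem mem_spaceLimited {N : ℕ} {P : Set (EuclideanSpace ℝ (Fin N))} {f : L2Space N} :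
    f ∈ spaceLimited P ↔ ∀ᵐ x, x ∉ P → f x = 0 := Iff.rfl

theorem isClosed_spaceLimited {N : ℕ} (P : Set (EuclideanSpace ℝ (Fin N))) :
    IsClosed (spaceLimited P : Set (L2Space N)) := by
  refine IsSeqClosed.isClosed ?_
  intro u f hu hf
  obtain ⟨φ, -, hφ⟩ := (tendstoInMeasure_of_tendsto_Lp hf).exists_seq_tendsto_ae
  have h : ∀ᵐ x, ∀ n, x ∉ P → u n x = 0 := ae_all_iff.2 fun n => hu n
  show ∀ᵐ x, x ∉ P → f x = 0
  filter_upwards [hφ, h] with x h1 h2 hx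
  refine tendsto_nhds_unique h1 ?_
  simp only [h2 _ hx]
  exact tendsto_const_nhds

/-- The subspace of all `f ∈ L²(ℝᴺ)` whose Fourier transform
`u ↦ ∫ f(x) exp(-i x · u) dx` vanishes at (almost every) `u ∉ Q`.
Mathlib's transform `𝓕 f ξ = ∫ f(x) exp(-2πi x · ξ) dx` is the value of that transform at
`u = 2π ξ`, so the condition is that `𝓕 f ξ = 0` for (almost every) `ξ` with `2π ξ ∉ Q`. -/
def bandLimited {N : ℕ} (Q : Set (EuclideanSpace ℝ (Fin N))) : Submodule ℂ (L2Space N) :=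
  (spaceLimited {ξ | (2 * Real.pi) • ξ ∈ Q}).comap
    (Lp.fourierTransformₗᵢ (EuclideanSpace ℝ (Fin N)) ℂ).toLinearEquiv.toLinearMap

theorem mem_bandLimited {N : ℕ} {Q : Set (EuclideanSpace ℝ (Fin N))} {f : L2Space N} :
    f ∈ bandLimited Q ↔
      ∀ᵐ ξ : EuclideanSpace ℝ (Fin N), (2 * Real.pi) • ξ ∉ Q → (𝓕 f : L2Space N) ξ = 0 :=
  Iff.rfl

theorem isClosed_bandLimited {N : ℕ} (Q : Set (EuclideanSpace ℝ (Fin N))) :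
    IsClosed (bandLimited Q : Set (L2Space N)) :=
  (isClosed_spaceLimited {ξ | (2 * Real.pi) • ξ ∈ Q}).preimage
    (Lp.fourierTransformₗᵢ (EuclideanSpace ℝ (Fin N)) ℂ).continuous

instance {N : ℕ} (P : Set (EuclideanSpace ℝ (Fin N))) :
    (spaceLimited P).HasOrthogonalProjection :=
  haveI : CompleteSpace (spaceLimited P) := (isClosed_spaceLimited P).completeSpace_coe
  inferInstance

instance {N : ℕ} (Q : Set (EuclideanSpace ℝ (Fin N))) :
    (bandLimited Q).HasOrthogonalProjection :=
  haveI : CompleteSpace (bandLimited Q) := (isClosed_bandLimited Q).completeSpace_coe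
  inferInstance

/-- The orthogonal projection of `L²(ℝᴺ)` onto the functions supported in `P`. -/
def spaceProj {N : ℕ} (P : Set (EuclideanSpace ℝ (Fin N))) : L2Space N →L[ℂ] L2Space N :=
  (spaceLimited P).starProjection

/-- The orthogonal projection of `L²(ℝᴺ)` onto the functions with Fourier transform
supported in `Q`. -/
def bandProj {N : ℕ} (Q : Set (EuclideanSpace ℝ (Fin N))) : L2Space N →L[ℂ] L2Space N :=
  (bandLimited Q).starProjection

/-- The operator `T_P B_Q T_P`. -/
def limitingOperator {N : ℕ} (P Q : Set (EuclideanSpace ℝ (Fin N))) :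
    L2Space N →L[ℂ] L2Space N :=
  spaceProj P ∘L bandProj Q ∘L spaceProj P

/-- The number, counted with multiplicity, of the (real) eigenvalues `μ ≥ ε` of an operator `T`;
each `μ` contributes the dimension of its eigenspace (`0` if `μ` is not an eigenvalue, `∞` if
the eigenspace has infinite dimension). -/
def eigenvalueCount {H : Type*} [AddCommGroup H] [Module ℂ H] (T : Module.End ℂ H) (ε : ℝ) :
    ℝ≥0∞ :=
  ∑' μ : Set.Ici ε, (Cardinal.toENat (Module.rank ℂ (T.eigenspace ((μ : ℝ) : ℂ))) : ℝ≥0∞)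

/-- The image `A P = {A x : x ∈ P}` of a set under a real `N × N` matrix. -/
def matImage {N : ℕ} (A : Matrix (Fin N) (Fin N) ℝ) (P : Set (EuclideanSpace ℝ (Fin N))) :
    Set (EuclideanSpace ℝ (Fin N)) :=
  A.toEuclideanLin '' P

end

/-! Write `T` for the operator and `T = K* K` with `K = B_{BQ} T_{AP}`, so that `0 ≤ T ≤ 1`. Put `d
= |det A| |det B|` and `R = Q / 2π`, the form `Q` takes in Mathlib's frequency variable.

The trace is known exactly: `tr T = d m(P) m(R)`, which is `d` times the claimed limit
(`tsum_enorm_bandProj_spaceProj`). The trace of the square is the double integral over `AP × AP` of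
the squared band kernel (`tsum_enorm_limitingOperator`). With `D = (Bᵀ A)⁻¹`, a linear change of
variables turns it into `d ∫_P ∫ 1_P(x + D z) |k_R(z)|² dz dx` (`lintegral_bandKernel_matImage`).
The hypothesis on `Bᵀ A U` forces `D → 0`. For open `P`, dominated convergence and Plancherel then
send the last integral to `m(P) m(R)` (`tendsto_overlapIntegral`), so `tr T - tr T² = o(d)`.

In terms of eigenvalues, `∑ μ (1 - μ) = o(d)`: almost all of the trace comes from eigenvalues near
`1`. The number of eigenvalues `≥ ε` differs from `∑ μ` by at most a constant `C(ε)` times `∑ μ (1 -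
μ)` (`eigenvalueCount_bounds`), which gives the limit. Null boundaries allow `P` and `Q` to be
replaced by their interiors. -/

noncomputable section

open scoped InnerProductSpace

/-! ### Compact symmetric operators and eigenvalue counts. -/

/-- A Hilbert–Schmidt operator is compact. -/
theorem isCompactOperator_of_tsum_enorm_sq_ne_top {ι H H' : Type*}
    [NormedAddCommGroup H] [InnerProductSpace ℂ H]
    [NormedAddCommGroup H'] [InnerProductSpace ℂ H'] [CompleteSpace H']
    (b : HilbertBasis ι ℂ H) (T : H →L[ℂ] H') (h : ∑' i, ‖T (b i)‖ₑ ^ 2 ≠ ∞) :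
    IsCompactOperator T := by
  classical
  have hs : Summable fun i => ‖T (b i)‖ ^ 2 := by
    have h2 := ENNReal.summable_toReal h
    refine h2.congr fun i => ?_
    simp
  set S : Finset ι → (H →L[ℂ] H') := fun F =>
    ∑ i ∈ F, (innerSL ℂ (b i)).smulRight (T (b i)) with hS
  have hSc : ∀ F, IsCompactOperator (S F) := by
    intro F
    have hmem : S F ∈ compactOperator (RingHom.id ℂ) H H' := by
      refine Submodule.sum_mem _ fun i _ => ?_
      have h1 : IsCompactOperator (ContinuousLinearMap.toSpanSingleton ℂ (T (b i))) :=
        isCompactOperator_of_locallyCompactSpace_rng _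
      exact h1.comp_clm (innerSL ℂ (b i))
    exact hmem
  have hsum : ∀ x, Tendsto (fun F => S F x) atTop (𝓝 (T x)) := by
    intro x
    have h1 := (b.hasSum_repr x).mapL T
    have h2 : Tendsto (fun F => ∑ i ∈ F, T ((b.repr x) i • b i)) atTop (𝓝 (T x)) := h1
    refine h2.congr fun F => ?_
    simp [hS, b.repr_apply_apply]
  -- The finite-rank truncations `S F` converge in operator norm: by Cauchy–Schwarz and Bessel the
  -- error is at most the `ℓ²` tail of `‖T (b i)‖`.
  have hdiff : ∀ F, ‖T - S F‖ ≤ Real.sqrt (∑' i : {i // i ∉ F}, ‖T (b i)‖ ^ 2) := by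
    intro F
    refine ContinuousLinearMap.opNorm_le_bound _ (Real.sqrt_nonneg _) fun x => ?_
    have hlim : Tendsto (fun G => ‖S G x - S F x‖) atTop (𝓝 ‖(T - S F) x‖) :=
      ((hsum x).sub_const _).norm
    refine le_of_tendsto hlim ?_
    filter_upwards [eventually_ge_atTop F] with G hG
    have e1 : S G x - S F x = ∑ i ∈ G \ F, ⟪b i, x⟫_ℂ • T (b i) := by
      rw [sub_eq_iff_eq_add]
      simp only [hS, sum_apply, ContinuousLinearMap.smulRight_apply,
        innerSL_apply_apply]
      rw [Finset.sum_sdiff hG]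
    rw [e1]
    have e2 : ∑ i ∈ G \ F, ‖T (b i)‖ ^ 2 ≤ ∑' i : {i // i ∉ F}, ‖T (b i)‖ ^ 2 := by
      have hs' : Summable fun i : {i // i ∉ F} => ‖T (b i)‖ ^ 2 := hs.subtype _
      have := hs'.sum_le_tsum ((G \ F).subtype (fun i => i ∉ F)) (fun _ _ => by positivity)
      refine le_trans (le_of_eq ?_) this
      rw [Finset.sum_subtype_eq_sum_filter (f := fun i => ‖T (b i)‖ ^ 2)]
      congr 1
      ext i; simp
    have e3 : ∑ i ∈ G \ F, ‖⟪b i, x⟫_ℂ‖ ^ 2 ≤ ‖x‖ ^ 2 := b.orthonormal.sum_inner_products_le x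
    calc ‖∑ i ∈ G \ F, ⟪b i, x⟫_ℂ • T (b i)‖
        ≤ ∑ i ∈ G \ F, ‖T (b i)‖ * ‖⟪b i, x⟫_ℂ‖ := by
          refine (norm_sum_le _ _).trans (Finset.sum_le_sum fun i _ => ?_)
          rw [norm_smul, mul_comm]
      _ ≤ Real.sqrt (∑ i ∈ G \ F, ‖T (b i)‖ ^ 2) * Real.sqrt (∑ i ∈ G \ F, ‖⟪b i, x⟫_ℂ‖ ^ 2) :=
          Real.sum_mul_le_sqrt_mul_sqrt _ _ _
      _ ≤ Real.sqrt (∑' i : {i // i ∉ F}, ‖T (b i)‖ ^ 2) * ‖x‖ := by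
          refine mul_le_mul (Real.sqrt_le_sqrt e2) ?_ (Real.sqrt_nonneg _) (Real.sqrt_nonneg _)
          exact (Real.sqrt_le_sqrt e3).trans (le_of_eq (Real.sqrt_sq (norm_nonneg _)))
  refine isCompactOperator_of_tendsto (l := atTop) (F := S) (f := T) ?_ (Eventually.of_forall hSc)
  rw [tendsto_iff_norm_sub_tendsto_zero]
  have h0 : Tendsto (fun F : Finset ι => Real.sqrt (∑' i : {i // i ∉ F}, ‖T (b i)‖ ^ 2)) atTop
      (𝓝 0) := by
    have := (Real.continuous_sqrt.tendsto 0).comp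
      (tendsto_tsum_compl_atTop_zero fun i => ‖T (b i)‖ ^ 2)
    rwa [Real.sqrt_zero] at this
  refine squeeze_zero (fun _ => norm_nonneg _) (fun F => ?_) h0
  rw [norm_sub_rev]
  exact hdiff F

/-- A compact symmetric operator has a Hilbert basis of eigenvectors, grouped by eigenvalue. -/
theorem exists_hilbertBasis_eigenspace {H : Type*} [NormedAddCommGroup H]
    [InnerProductSpace ℂ H] [CompleteSpace H] {T : H →L[ℂ] H} (hT : IsCompactOperator T)
    (hsymm : T.toLinearMap.IsSymmetric) :
    ∃ (w : ∀ μ : ℝ, Set (Module.End.eigenspace T.toLinearMap (μ : ℂ)))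
      (_ : ∀ μ, HilbertBasis (w μ) ℂ (Module.End.eigenspace T.toLinearMap (μ : ℂ)))
      (b : HilbertBasis (Σ μ, w μ) ℂ H), ∀ x, b x = (x.2 : Module.End.eigenspace T.toLinearMap (x.1 : ℂ)) := by
  have hcl : ∀ μ : ℝ, CompleteSpace (Module.End.eigenspace T.toLinearMap (μ : ℂ)) := by
    intro μ
    have : IsClosed (Module.End.eigenspace T.toLinearMap (μ : ℂ) : Set H) := by
      have e : (Module.End.eigenspace T.toLinearMap (μ : ℂ) : Set H) = {x | T x = (μ : ℂ) • x} := by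
        ext x; simp
      rw [e]
      exact isClosed_eq T.continuous (continuous_const_smul _)
    exact this.completeSpace_coe
  choose w c hc using fun μ : ℝ => exists_hilbertBasis ℂ (Module.End.eigenspace T.toLinearMap (μ : ℂ))
  refine ⟨w, c, ?_⟩
  have horth : OrthogonalFamily ℂ (fun μ : ℝ => Module.End.eigenspace T.toLinearMap (μ : ℂ))
      fun μ => (Module.End.eigenspace T.toLinearMap (μ : ℂ)).subtypeₗᵢ :=
    hsymm.orthogonalFamily_eigenspaces.comp Complex.ofReal_injective
  have hon : Orthonormal ℂ (fun x : Σ μ, w μ =>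
      (Module.End.eigenspace T.toLinearMap (x.1 : ℂ)).subtypeₗᵢ (c x.1 x.2)) :=
    horth.orthonormal_sigma_orthonormal fun μ => (c μ).orthonormal
  have hsp : (Submodule.span ℂ (Set.range fun x : Σ μ, w μ =>
      (Module.End.eigenspace T.toLinearMap (x.1 : ℂ)).subtypeₗᵢ (c x.1 x.2)))ᗮ = ⊥ := by
    rw [← ContinuousLinearMap.orthogonalComplement_iSup_eigenspaces_eq_bot hT hsymm]
    refine le_antisymm ?_ (Submodule.orthogonal_le ?_)
    · rw [← Submodule.orthogonal_closure]
      refine Submodule.orthogonal_le ?_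
      refine iSup_le fun μ => ?_
      by_cases hμ : Module.End.eigenspace T.toLinearMap μ = ⊥
      · rw [hμ]; exact bot_le
      -- Eigenvalues of a symmetric operator are real, so the eigenspaces indexed by `ℝ` exhaust
      -- those indexed by `ℂ`.
      · have hreal : ((μ.re : ℝ) : ℂ) = μ :=
          Complex.conj_eq_iff_re.1 (hsymm.conj_eigenvalue_eq_self hμ)
        rw [← hreal]
        intro x hx
        have hd : (⟨x, hx⟩ : Module.End.eigenspace T.toLinearMap ((μ.re : ℝ) : ℂ)) ∈
            (Submodule.span ℂ (Set.range (c μ.re))).topologicalClosure := by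
          rw [(c μ.re).dense_span]; trivial
        have := map_mem_closure
          (t := (Submodule.span ℂ (Set.range fun x : Σ μ, w μ =>
      (Module.End.eigenspace T.toLinearMap (x.1 : ℂ)).subtypeₗᵢ (c x.1 x.2)) : Set H))
          (Module.End.eigenspace T.toLinearMap ((μ.re : ℝ) : ℂ)).subtypeₗᵢ.continuous hd ?_
        · exact this
        · intro y hy
          refine Submodule.span_induction (p := fun y _ =>
            (Module.End.eigenspace T.toLinearMap ((μ.re : ℝ) : ℂ)).subtypeₗᵢ y ∈ Submodule.span ℂ
              (Set.range fun x : Σ μ, w μ =>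
                (Module.End.eigenspace T.toLinearMap (x.1 : ℂ)).subtypeₗᵢ (c x.1 x.2))) ?_ ?_ ?_ ?_ hy
          · rintro _ ⟨i, rfl⟩
            exact Submodule.subset_span ⟨⟨μ.re, i⟩, rfl⟩
          · simp
          · intro x y _ _ hx hy
            rw [map_add]; exact Submodule.add_mem _ hx hy
          · intro a x _ hx
            rw [map_smul]; exact Submodule.smul_mem _ _ hx
    · rw [Submodule.span_le]
      rintro _ ⟨x, rfl⟩
      exact Submodule.mem_iSup_of_mem (x.1 : ℂ) (c x.1 x.2).2
  refine ⟨HilbertBasis.mkOfOrthogonalEqBot hon hsp, fun x => ?_⟩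
  rw [HilbertBasis.coe_mkOfOrthogonalEqBot]
  simp [hc]

/-- The eigenvalue count of a compact operator, computed on a Hilbert basis of eigenvectors. -/
theorem eigenvalueCount_eq_tsum {H : Type*} [NormedAddCommGroup H]
    [InnerProductSpace ℂ H] [CompleteSpace H] {T : H →L[ℂ] H} (hT : IsCompactOperator T)
    {w : ∀ μ : ℝ, Set (Module.End.eigenspace T.toLinearMap (μ : ℂ))}
    (c : ∀ μ, HilbertBasis (w μ) ℂ (Module.End.eigenspace T.toLinearMap (μ : ℂ)))
    {ε : ℝ} (hε : 0 < ε) :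
    eigenvalueCount T.toLinearMap ε = ∑' x : Σ μ, w μ, if ε ≤ x.1 then 1 else 0 := by
  have key : ∀ μ : ℝ, ε ≤ μ →
      (Cardinal.toENat (Module.rank ℂ (Module.End.eigenspace T.toLinearMap (μ : ℂ))) : ℝ≥0∞) =
        ∑' _ : w μ, (1 : ℝ≥0∞) := by
    intro μ hμ
    have : FiniteDimensional ℂ (Module.End.eigenspace T.toLinearMap (μ : ℂ)) :=
      ContinuousLinearMap.finite_dimensional_eigenspace hT _ (by
        exact_mod_cast (hε.trans_le hμ).ne')
    have hfin : Finite (w μ) := (c μ).orthonormal.linearIndependent.finite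
    have : Fintype (w μ) := Fintype.ofFinite _
    rw [rank_eq_card_basis (c μ).toOrthonormalBasis.toBasis, ENNReal.tsum_const]
    simp
  rw [ENNReal.tsum_sigma (fun μ (_ : w μ) => if ε ≤ μ then (1 : ℝ≥0∞) else 0)]
  rw [eigenvalueCount, tsum_subtype (Set.Ici ε) (fun μ : ℝ =>
    (Cardinal.toENat (Module.rank ℂ (Module.End.eigenspace T.toLinearMap (μ : ℂ))) : ℝ≥0∞))]
  refine tsum_congr fun μ => ?_
  by_cases h : ε ≤ μ
  · rw [Set.indicator_of_mem (show μ ∈ Set.Ici ε from h), key μ h]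
    simp [h]
  · rw [Set.indicator_of_notMem (show μ ∉ Set.Ici ε from h)]
    simp [h]

/-- For `T = K* K` Hilbert–Schmidt with `‖K‖ ≤ 1`, the number of eigenvalues `≥ ε` differs from
`tr T` by at most a constant times `tr T - tr T²`. -/
theorem eigenvalueCount_bounds {H H' : Type} [NormedAddCommGroup H]
    [InnerProductSpace ℂ H] [CompleteSpace H] [NormedAddCommGroup H'] [InnerProductSpace ℂ H']
    {T : H →L[ℂ] H} {K : H →L[ℂ] H'} (hK : ‖K‖ ≤ 1) (hsymm : T.toLinearMap.IsSymmetric)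
    (hTK : ∀ x, ⟪x, T x⟫_ℂ = ((‖K x‖ ^ 2 : ℝ) : ℂ)) {s t : ℝ≥0∞}
    (ht : ∀ {ι : Type} (b : HilbertBasis ι ℂ H), ∑' i, ‖K (b i)‖ₑ ^ 2 = t)
    (hs : ∀ {ι : Type} (b : HilbertBasis ι ℂ H), ∑' i, ‖T (b i)‖ₑ ^ 2 = s)
    (ht_top : t ≠ ∞) (hst : s ≤ t) {ε : ℝ} (hε0 : 0 < ε) (hε1 : ε < 1) :
    eigenvalueCount T.toLinearMap ε ≤ t + ENNReal.ofReal (ε⁻¹ + (1 - ε)⁻¹) * (t - s) ∧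
      t ≤ eigenvalueCount T.toLinearMap ε + ENNReal.ofReal (ε⁻¹ + (1 - ε)⁻¹) * (t - s) := by
  have hs_top : s ≠ ∞ := ne_top_of_le_ne_top ht_top hst
  have hcomp : IsCompactOperator T := by
    obtain ⟨w, b, -⟩ := exists_hilbertBasis ℂ H
    exact isCompactOperator_of_tsum_enorm_sq_ne_top b T (by rw [hs b]; exact hs_top)
  obtain ⟨w, c, b, hb⟩ := exists_hilbertBasis_eigenspace hcomp hsymm
  rw [eigenvalueCount_eq_tsum hcomp c hε0]
  have hTb : ∀ x, T (b x) = ((x.1 : ℝ) : ℂ) • b x := fun x => by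
    rw [hb x]
    exact Module.End.mem_eigenspace_iff.1 (x.2 : Module.End.eigenspace T.toLinearMap (x.1 : ℂ)).2
  have hKb : ∀ x, ‖K (b x)‖ ^ 2 = x.1 := fun x => by
    have h1 := hTK (b x)
    rw [hTb x, inner_smul_right, inner_self_eq_norm_sq_to_K, b.orthonormal.1 x] at h1
    have h2 : ((x.1 : ℝ) : ℂ) = ((‖K (b x)‖ ^ 2 : ℝ) : ℂ) := by simpa using h1
    exact_mod_cast h2.symm
  have h0 : ∀ x : Σ μ, w μ, 0 ≤ x.1 := fun x => by rw [← hKb x]; positivity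
  have h1 : ∀ x : Σ μ, w μ, x.1 ≤ 1 := fun x => by
    rw [← hKb x]
    have : ‖K (b x)‖ ≤ 1 := by
      have := K.le_of_opNorm_le hK (b x)
      rwa [b.orthonormal.1 x, one_mul] at this
    exact pow_le_one₀ (norm_nonneg _) this
  have ht' : ∑' x : Σ μ, w μ, ENNReal.ofReal x.1 = t := by
    rw [← ht b]
    refine tsum_congr fun x => ?_
    rw [← hKb x, ← ofReal_norm, ENNReal.ofReal_pow (norm_nonneg _)]
  have hs' : ∑' x : Σ μ, w μ, ENNReal.ofReal (x.1 ^ 2) = s := by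
    rw [← hs b]
    refine tsum_congr fun x => ?_
    rw [hTb x, ← ofReal_norm, norm_smul, b.orthonormal.1 x, mul_one, Complex.norm_real,
      Real.norm_of_nonneg (h0 x), ENNReal.ofReal_pow (h0 x)]
  -- The defect `tr T - tr T²` is `∑ μ (1 - μ)`, with nonnegative terms.
  have hu' : ∑' x : Σ μ, w μ, ENNReal.ofReal (x.1 * (1 - x.1)) = t - s := by
    refine ENNReal.eq_sub_of_add_eq hs_top ?_
    rw [← hs', ← ht', ← ENNReal.tsum_add]
    refine tsum_congr fun x => ?_
    rw [← ENNReal.ofReal_add (mul_nonneg (h0 x) (sub_nonneg.2 (h1 x))) (sq_nonneg _)]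
    congr 1; ring
  have hC : 0 ≤ ε⁻¹ + (1 - ε)⁻¹ := add_nonneg (inv_nonneg.2 hε0.le) (inv_nonneg.2 (by linarith))
  -- The two halves of the constant: `1 - μ ≤ ε⁻¹ μ (1 - μ)` when `μ ≥ ε`, and `μ ≤ (1 - ε)⁻¹ μ (1 -
  -- μ)` when `μ < ε`.
  have hbig : ∀ μ : ℝ, 0 ≤ μ → μ ≤ 1 → ε ≤ μ →
      1 ≤ μ + (ε⁻¹ + (1 - ε)⁻¹) * (μ * (1 - μ)) := by
    intro μ h0 h1 h2
    have e1 : 1 ≤ ε⁻¹ * μ := by rw [inv_mul_eq_div, le_div_iff₀ hε0]; linarith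
    have e2 : 0 ≤ (1 - ε)⁻¹ * (μ * (1 - μ)) :=
      mul_nonneg (inv_nonneg.2 (by linarith)) (mul_nonneg h0 (by linarith))
    nlinarith [mul_le_mul_of_nonneg_right e1 (show 0 ≤ 1 - μ by linarith)]
  have hsmall : ∀ μ : ℝ, 0 ≤ μ → μ ≤ 1 → μ < ε →
      μ ≤ (ε⁻¹ + (1 - ε)⁻¹) * (μ * (1 - μ)) := by
    intro μ h0 h1 h2
    have e1 : 1 ≤ (1 - ε)⁻¹ * (1 - μ) := by
      rw [inv_mul_eq_div, le_div_iff₀ (by linarith)]; linarith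
    have e2 : 0 ≤ ε⁻¹ * (μ * (1 - μ)) :=
      mul_nonneg (inv_nonneg.2 hε0.le) (mul_nonneg h0 (by linarith))
    nlinarith [mul_le_mul_of_nonneg_left e1 h0]
  rw [← hu', ← ht', ← ENNReal.tsum_mul_left, ← ENNReal.tsum_add, ← ENNReal.tsum_add]
  constructor <;> refine ENNReal.tsum_le_tsum fun x => ?_
  · rw [← ENNReal.ofReal_mul hC, ← ENNReal.ofReal_add (h0 x)
      (mul_nonneg hC (mul_nonneg (h0 x) (sub_nonneg.2 (h1 x))))]
    split_ifs with h
    · rw [ENNReal.one_le_ofReal]; exact hbig _ (h0 x) (h1 x) h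
    · exact zero_le
  · rw [← ENNReal.ofReal_mul hC]
    split_ifs with h
    · refine le_add_right ?_
      rw [ENNReal.ofReal_le_one]; exact h1 x
    · rw [zero_add]
      exact ENNReal.ofReal_le_ofReal (hsmall _ (h0 x) (h1 x) (not_le.1 h))

/-! ### The Fourier transform on `L¹ ∩ L²` as an integral. -/

open scoped ContDiff SchwartzMap in
theorem ae_eq_of_integral_schwartz_mul_eq {V : Type*} [NormedAddCommGroup V]
    [InnerProductSpace ℝ V] [FiniteDimensional ℝ V] [MeasurableSpace V] [BorelSpace V]
    {f g : V → ℂ} (hf : LocallyIntegrable f) (hg : LocallyIntegrable g)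
    (h : ∀ φ : 𝓢(V, ℂ), ∫ x, φ x • f x = ∫ x, φ x • g x) : f =ᵐ[volume] g := by
  refine ae_eq_of_integral_contDiff_smul_eq hf hg fun φ hφ hφc => ?_
  have h1 : HasCompactSupport (Complex.ofRealCLM ∘ φ) := hφc.comp_left rfl
  have h2 : ContDiff ℝ ∞ (Complex.ofRealCLM ∘ φ) := by fun_prop
  have := h (h1.toSchwartzMap h2)
  simpa using this

/-- On `L¹ ∩ L²` the Fourier transform of `L²` is given by the Fourier integral. -/
theorem Lp_fourier_ae_eq {V : Type*} [NormedAddCommGroup V]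
    [InnerProductSpace ℝ V] [FiniteDimensional ℝ V] [MeasurableSpace V] [BorelSpace V]
    (f : Lp ℂ 2 (volume : Measure V)) (hf : Integrable f) :
    (𝓕 f : Lp ℂ 2 (volume : Measure V)) =ᵐ[volume] 𝓕 (f : V → ℂ) := by
  have hcont : Continuous (𝓕 (f : V → ℂ)) :=
    VectorFourier.fourierIntegral_continuous Real.continuous_fourierChar
      (L := innerₗ V) continuous_inner hf
  refine ae_eq_of_integral_schwartz_mul_eq ((Lp.memLp _).locallyIntegrable (by norm_num))
    hcont.locallyIntegrable fun φ => ?_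
  -- The `L²` transform agrees with the distributional one, which moves `𝓕` onto `φ`; the exchange
  -- formula for integrable functions moves it back onto `f`.
  have h1 := congrArg (fun S => S φ) (Lp.fourier_toTemperedDistribution_eq f)
  simp only [TemperedDistribution.fourier_apply, Lp.toTemperedDistribution_apply] at h1
  rw [← h1]
  have h2 := VectorFourier.integral_fourierIntegral_smul_eq_flip (L := innerₗ V)
      Real.continuous_fourierChar continuous_inner φ.integrable hf (μ := volume) (ν := volume)
  rw [flip_innerₗ] at h2
  exact h2

/-- On `L¹ ∩ L²` the inverse Fourier transform of `L²` is given by the Fourier integral. -/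
theorem Lp_fourierInv_ae_eq {V : Type*} [NormedAddCommGroup V]
    [InnerProductSpace ℝ V] [FiniteDimensional ℝ V] [MeasurableSpace V] [BorelSpace V]
    (f : Lp ℂ 2 (volume : Measure V)) (hf : Integrable f) :
    (𝓕⁻ f : Lp ℂ 2 (volume : Measure V)) =ᵐ[volume] 𝓕⁻ (f : V → ℂ) := by
  have hc : Continuous fun p : V × V => (-innerₗ V) p.1 p.2 := by
    simp only [LinearMap.neg_apply, innerₗ_apply_apply]; fun_prop
  have hcont : Continuous (𝓕⁻ (f : V → ℂ)) :=
    VectorFourier.fourierIntegral_continuous Real.continuous_fourierChar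
      (L := -innerₗ V) hc hf
  refine ae_eq_of_integral_schwartz_mul_eq ((Lp.memLp _).locallyIntegrable (by norm_num))
    hcont.locallyIntegrable fun φ => ?_
  have h1 := congrArg (fun S => S φ) (Lp.fourierInv_toTemperedDistribution_eq f)
  simp only [TemperedDistribution.fourierInv_apply, Lp.toTemperedDistribution_apply] at h1
  rw [← h1]
  have h2 := VectorFourier.integral_fourierIntegral_smul_eq_flip (L := -innerₗ V)
      Real.continuous_fourierChar hc φ.integrable hf (μ := volume) (ν := volume)
  have h3 : (-innerₗ V).flip = -innerₗ V := by
    ext x y; simp [real_inner_comm]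
  rw [h3] at h2
  rw [SchwartzMap.fourierInv_coe]
  exact h2

/-! ### Hilbert–Schmidt norms from representing vectors. -/

variable {N : ℕ}

theorem L2Space_enorm_sq {α : Type*} [MeasurableSpace α] {ν : Measure α} (f : Lp ℂ 2 ν) :
    ‖f‖ₑ ^ 2 = ∫⁻ x, ‖f x‖ₑ ^ 2 ∂ν := by
  rw [Lp.enorm_def, eLpNorm_eq_lintegral_rpow_enorm_toReal (by norm_num) (by norm_num)]
  rw [← ENNReal.rpow_natCast, ← ENNReal.rpow_mul]
  simp

theorem HilbertBasis.tsum_enorm_inner_sq {ι H : Type*} [NormedAddCommGroup H]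
    [InnerProductSpace ℂ H] (b : HilbertBasis ι ℂ H) (g : H) :
    ∑' i, ‖⟪g, b i⟫_ℂ‖ₑ ^ 2 = ‖g‖ₑ ^ 2 := by
  have h1 := b.hasSum_inner_mul_inner g g
  have h2 : HasSum (fun i => ‖⟪g, b i⟫_ℂ‖ ^ 2) (‖g‖ ^ 2) := by
    have h3 := (Complex.hasSum_re h1)
    convert h3 using 1
    · funext i
      have h4 := inner_mul_symm_re_eq_norm (𝕜 := ℂ) g (b i)
      rw [norm_mul, norm_inner_symm (b i) g] at h4
      rw [sq, ← h4]; rfl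
    · exact norm_sq_eq_re_inner (𝕜 := ℂ) g
  have h4 := ENNReal.ofReal_tsum_of_nonneg (fun i => by positivity) h2.summable
  rw [h2.tsum_eq] at h4
  simp only [ENNReal.ofReal_pow (norm_nonneg _), ofReal_norm] at h4
  exact h4.symm

/-- Distinct basis vectors are `√2` apart, so balls of radius `1/2` around them are disjoint.
Countability is what permits exchanging the sum over the basis with integrals and almost-everywhere
statements. -/
theorem HilbertBasis.countable {ι H : Type*} [NormedAddCommGroup H] [InnerProductSpace ℂ H]
    [TopologicalSpace.SeparableSpace H] (b : HilbertBasis ι ℂ H) : Countable ι := by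
  have hd : Pairwise fun i j => 1 ≤ dist (b i) (b j) := by
    intro i j hij
    have h := b.orthonormal
    have h1 : ‖b i - b j‖ ^ 2 = 2 := by
      rw [@norm_sub_sq ℂ, h.2 hij, h.1 i, h.1 j]
      norm_num
    rw [dist_eq_norm]
    nlinarith [norm_nonneg (b i - b j)]
  have : (Set.univ : Set ι).Countable := by
    refine Set.PairwiseDisjoint.countable_of_isOpen (s := fun i => Metric.ball (b i) (1 / 2))
      (fun i _ j _ hij => ?_) (fun _ _ => Metric.isOpen_ball)
      (fun i _ => ⟨b i, Metric.mem_ball_self (by norm_num)⟩)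
    exact Metric.ball_disjoint_ball (by linarith [hd hij])
  exact Set.countable_univ_iff.1 this

/-- The Hilbert–Schmidt norm of an operator given by a family of representing vectors. -/
theorem tsum_enorm_sq_eq_lintegral {ι : Type*} (b : HilbertBasis ι ℂ (L2Space N))
    (L : L2Space N → L2Space N) (g : EuclideanSpace ℝ (Fin N) → L2Space N)
    (h : ∀ f, ∀ᵐ x, L f x = ⟪g x, f⟫_ℂ) :
    ∑' i, ‖L (b i)‖ₑ ^ 2 = ∫⁻ x, ‖g x‖ₑ ^ 2 := by
  have : Fact ((2 : ℝ≥0∞) ≠ ∞) := ⟨by norm_num⟩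
  have hc : Countable ι := b.countable
  simp_rw [L2Space_enorm_sq (L _)]
  rw [← lintegral_tsum fun i => ((Lp.aestronglyMeasurable (L (b i))).enorm.pow_const 2)]
  refine lintegral_congr_ae ?_
  filter_upwards [ae_all_iff.2 fun i => h (b i)] with x hx
  simp_rw [hx]
  exact b.tsum_enorm_inner_sq (g x)

/-! ### The projections and their kernels. -/

theorem spaceProj_ae_eq {P : Set (EuclideanSpace ℝ (Fin N))} (hP : MeasurableSet P)
    (f : L2Space N) : spaceProj P f =ᵐ[volume] P.indicator f := by
  have hm := (Lp.memLp f).indicator hP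
  have : spaceProj P f = hm.toLp _ := by
    refine Submodule.eq_starProjection_of_mem_of_inner_eq_zero (K := spaceLimited P) ?_ ?_
    · rw [mem_spaceLimited]
      filter_upwards [hm.coeFn_toLp] with x hx hxP
      rw [hx, Set.indicator_of_notMem hxP]
    · intro w hw
      rw [L2.inner_def]
      refine integral_eq_zero_of_ae ?_
      filter_upwards [hm.coeFn_toLp, mem_spaceLimited.1 hw, Lp.coeFn_sub f (hm.toLp _)]
        with x h1 h2 h3
      rw [h3, Pi.sub_apply, h1]
      by_cases hx : x ∈ P
      · simp [hx]
      · simp [h2 hx]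
  rw [this]
  exact hm.coeFn_toLp

theorem spaceProj_mem (P : Set (EuclideanSpace ℝ (Fin N))) (f : L2Space N) :
    spaceProj P f ∈ spaceLimited P :=
  Submodule.starProjection_apply_mem (spaceLimited P) f

theorem inner_sub_spaceProj_eq_zero {P : Set (EuclideanSpace ℝ (Fin N))} (f : L2Space N)
    {w : L2Space N} (hw : w ∈ spaceLimited P) : ⟪f - spaceProj P f, w⟫_ℂ = 0 :=
  Submodule.starProjection_inner_eq_zero (K := spaceLimited P) f w hw

theorem mem_bandLimited_iff_fourier_mem {Q : Set (EuclideanSpace ℝ (Fin N))} {f : L2Space N} :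
    f ∈ bandLimited Q ↔
      (𝓕 f : L2Space N) ∈ spaceLimited {ξ | (2 * Real.pi) • ξ ∈ Q} := by
  rw [mem_bandLimited, mem_spaceLimited]
  simp only [Set.mem_ofPred_eq]

theorem bandProj_eq_of_mem {Q : Set (EuclideanSpace ℝ (Fin N))} {f g : L2Space N}
    (hg : g ∈ bandLimited Q) (h : ∀ w ∈ bandLimited Q, ⟪f - g, w⟫_ℂ = 0) : bandProj Q f = g :=
  Submodule.eq_starProjection_of_mem_of_inner_eq_zero (K := bandLimited Q) hg h

/-- The Fourier transform is unitary and carries `bandLimited Q` onto a space of functions supported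
in `Q / 2π`. -/
theorem bandProj_eq (Q : Set (EuclideanSpace ℝ (Fin N))) (f : L2Space N) :
    bandProj Q f = 𝓕⁻ (spaceProj {ξ | (2 * Real.pi) • ξ ∈ Q} (𝓕 f)) := by
  refine bandProj_eq_of_mem ?_ fun w hw => ?_
  · rw [mem_bandLimited_iff_fourier_mem, FourierTransform.fourier_fourierInv_eq]
    exact spaceProj_mem _ _
  · rw [← Lp.inner_fourier_eq, sub_eq_add_neg, FourierTransform.fourier_add,
      FourierTransform.fourier_neg, FourierTransform.fourier_fourierInv_eq, ← sub_eq_add_neg]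
    exact inner_sub_spaceProj_eq_zero _ (mem_bandLimited_iff_fourier_mem.1 hw)

theorem norm_bandProj (Q : Set (EuclideanSpace ℝ (Fin N))) (f : L2Space N) :
    ‖bandProj Q f‖ = ‖spaceProj {ξ | (2 * Real.pi) • ξ ∈ Q} (𝓕 f)‖ := by
  rw [bandProj_eq, ← Lp.norm_fourier_eq, FourierTransform.fourier_fourierInv_eq]

theorem memLp_indicator_fourierChar {S : Set (EuclideanSpace ℝ (Fin N))} (hS : MeasurableSet S)
    (hfin : volume S ≠ ∞) (p : ℝ≥0∞) (ξ : EuclideanSpace ℝ (Fin N)) :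
    MemLp (S.indicator fun x => (Real.fourierChar (inner ℝ x ξ) : ℂ)) p volume := by
  rw [memLp_indicator_iff_restrict hS]
  have : IsFiniteMeasure (volume.restrict S) := ⟨by simpa using hfin.lt_top⟩
  refine MemLp.of_bound (C := 1) ?_ (ae_of_all _ fun x => (Circle.norm_coe _).le)
  have : Continuous fun x : EuclideanSpace ℝ (Fin N) => (Real.fourierChar (inner ℝ x ξ) : ℂ) :=
    continuous_subtype_val.comp (Real.continuous_fourierChar.comp (by fun_prop))
  exact this.aestronglyMeasurable

/-- The exponential with frequency `ξ`, cut off to `S`, as an element of `L²`. -/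
def cutExp (S : Set (EuclideanSpace ℝ (Fin N))) (hS : MeasurableSet S) (hfin : volume S ≠ ∞)
    (ξ : EuclideanSpace ℝ (Fin N)) : L2Space N :=
  (memLp_indicator_fourierChar hS hfin 2 ξ).toLp _

theorem coeFn_cutExp {S : Set (EuclideanSpace ℝ (Fin N))} (hS : MeasurableSet S)
    (hfin : volume S ≠ ∞) (ξ : EuclideanSpace ℝ (Fin N)) :
    cutExp S hS hfin ξ =ᵐ[volume]
      S.indicator fun x => (Real.fourierChar (inner ℝ x ξ) : ℂ) :=
  MemLp.coeFn_toLp _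

theorem enorm_cutExp_sq {S : Set (EuclideanSpace ℝ (Fin N))} (hS : MeasurableSet S)
    (hfin : volume S ≠ ∞) (ξ : EuclideanSpace ℝ (Fin N)) :
    ‖cutExp S hS hfin ξ‖ₑ ^ 2 = volume S := by
  rw [L2Space_enorm_sq]
  have : ∀ᵐ x, ‖cutExp S hS hfin ξ x‖ₑ ^ 2 = S.indicator (fun _ => (1 : ℝ≥0∞)) x := by
    filter_upwards [coeFn_cutExp hS hfin ξ] with x hx
    rw [hx]
    by_cases h : x ∈ S
    · rw [Set.indicator_of_mem h, Set.indicator_of_mem h, ← ofReal_norm, Circle.norm_coe]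
      simp
    · simp [h]
  rw [lintegral_congr_ae this, lintegral_indicator_const hS, one_mul]

theorem integrable_spaceProj {S : Set (EuclideanSpace ℝ (Fin N))} (hS : MeasurableSet S)
    (hfin : volume S ≠ ∞) (f : L2Space N) : Integrable (spaceProj S f) := by
  have : IsFiniteMeasure (volume.restrict S) := ⟨by simpa using hfin.lt_top⟩
  rw [integrable_congr (spaceProj_ae_eq hS f), integrable_indicator_iff hS]
  exact ((Lp.memLp f).restrict S).integrable (by norm_num)

/-- Finite measure of `S` makes the cut-off function integrable, so its transform is a genuine
integral, that is, an inner product with `cutExp`. These are the representing vectors needed for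
`tsum_enorm_sq_eq_lintegral`. -/
theorem fourier_spaceProj_ae_eq {S : Set (EuclideanSpace ℝ (Fin N))} (hS : MeasurableSet S)
    (hfin : volume S ≠ ∞) (f : L2Space N) :
    ∀ᵐ ξ, (𝓕 (spaceProj S f) : L2Space N) ξ = ⟪cutExp S hS hfin ξ, f⟫_ℂ := by
  filter_upwards [Lp_fourier_ae_eq _ (integrable_spaceProj hS hfin f)] with ξ hξ
  rw [hξ, L2.inner_def, Real.fourier_eq]
  refine integral_congr_ae ?_
  filter_upwards [spaceProj_ae_eq hS f, coeFn_cutExp hS hfin ξ] with x h1 h2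
  rw [h1, h2]
  by_cases h : x ∈ S
  · simp [h, Circle.smul_def, mul_comm, AddChar.map_neg_eq_inv]
  · simp [h]

theorem fourierInv_spaceProj_ae_eq {S : Set (EuclideanSpace ℝ (Fin N))} (hS : MeasurableSet S)
    (hfin : volume S ≠ ∞) (f : L2Space N) :
    ∀ᵐ x, (𝓕⁻ (spaceProj S f) : L2Space N) x = ⟪cutExp S hS hfin (-x), f⟫_ℂ := by
  filter_upwards [Lp_fourierInv_ae_eq _ (integrable_spaceProj hS hfin f)] with x hx
  rw [hx, L2.inner_def, Real.fourierInv_eq]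
  refine integral_congr_ae ?_
  filter_upwards [spaceProj_ae_eq hS f, coeFn_cutExp hS hfin (-x)] with ξ h1 h2
  rw [h1, h2]
  by_cases h : ξ ∈ S
  · simp [h, Circle.smul_def, mul_comm, AddChar.map_neg_eq_inv]
  · simp [h]

/-- The convolution kernel of the projection onto band-limited functions. -/
def bandKernel (S : Set (EuclideanSpace ℝ (Fin N))) (x : EuclideanSpace ℝ (Fin N)) : ℂ :=
  ∫ ξ in S, (Real.fourierChar (inner ℝ ξ x) : ℂ)

theorem fourierInv_cutExp_ae_eq {S : Set (EuclideanSpace ℝ (Fin N))} (hS : MeasurableSet S)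
    (hfin : volume S ≠ ∞) (x : EuclideanSpace ℝ (Fin N)) :
    ∀ᵐ y, (𝓕⁻ (cutExp S hS hfin x) : L2Space N) y = bandKernel S (x + y) := by
  have hi : Integrable (cutExp S hS hfin x) := by
    rw [integrable_congr (coeFn_cutExp hS hfin x), ← memLp_one_iff_integrable]
    exact memLp_indicator_fourierChar hS hfin 1 x
  filter_upwards [Lp_fourierInv_ae_eq _ hi] with y hy
  rw [hy, Real.fourierInv_eq, bandKernel, ← integral_indicator hS]
  refine integral_congr_ae ?_
  filter_upwards [coeFn_cutExp hS hfin x] with ξ h1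
  rw [h1]
  by_cases h : ξ ∈ S
  · simp [h, Circle.smul_def, mul_comm, AddChar.map_add_eq_mul, inner_add_right]
  · simp [h]

/-- Plancherel: the kernel is the inverse transform of the indicator of `S`, which is `cutExp` at
frequency `0`. -/
theorem lintegral_enorm_bandKernel_sq {S : Set (EuclideanSpace ℝ (Fin N))}
    (hS : MeasurableSet S) (hfin : volume S ≠ ∞) :
    ∫⁻ x, ‖bandKernel S x‖ₑ ^ 2 = volume S := by
  rw [← enorm_cutExp_sq hS hfin 0]
  have h1 : ‖(𝓕⁻ (cutExp S hS hfin 0) : L2Space N)‖ₑ = ‖cutExp S hS hfin 0‖ₑ := by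
    rw [← ofReal_norm, ← ofReal_norm, ← Lp.norm_fourier_eq,
      FourierTransform.fourier_fourierInv_eq]
  rw [← h1, L2Space_enorm_sq]
  refine lintegral_congr_ae ?_
  filter_upwards [fourierInv_cutExp_ae_eq hS hfin 0] with y hy
  rw [hy, zero_add]

/-! ### The traces of `T` and `T²`. -/

theorem tsum_enorm_bandProj_spaceProj {P Q : Set (EuclideanSpace ℝ (Fin N))}
    (hP : MeasurableSet P) (hPfin : volume P ≠ ∞)
    (hQ : MeasurableSet {ξ : EuclideanSpace ℝ (Fin N) | (2 * Real.pi) • ξ ∈ Q})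
    {ι : Type*} (b : HilbertBasis ι ℂ (L2Space N)) :
    ∑' i, ‖bandProj Q (spaceProj P (b i))‖ₑ ^ 2 =
      volume P * volume {ξ : EuclideanSpace ℝ (Fin N) | (2 * Real.pi) • ξ ∈ Q} := by
  set R := {ξ : EuclideanSpace ℝ (Fin N) | (2 * Real.pi) • ξ ∈ Q} with hR
  have h1 : ∀ f : L2Space N,
      ‖bandProj Q (spaceProj P f)‖ₑ = ‖spaceProj R (𝓕 (spaceProj P f))‖ₑ := fun f => by
    rw [← ofReal_norm, norm_bandProj, ofReal_norm]
  simp_rw [h1]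
  rw [tsum_enorm_sq_eq_lintegral b (fun f => spaceProj R (𝓕 (spaceProj P f)))
    (R.indicator fun ξ => cutExp P hP hPfin ξ)]
  · have : ∀ ξ, ‖R.indicator (fun ξ => cutExp P hP hPfin ξ) ξ‖ₑ ^ 2 =
        R.indicator (fun _ => volume P) ξ := by
      intro ξ
      by_cases h : ξ ∈ R
      · simp [h, enorm_cutExp_sq]
      · simp [h]
    simp_rw [this]
    rw [lintegral_indicator_const hQ]
  · intro f
    filter_upwards [spaceProj_ae_eq hQ (𝓕 (spaceProj P f)), fourier_spaceProj_ae_eq hP hPfin f]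
      with ξ h1 h2
    rw [h1]
    by_cases h : ξ ∈ R
    · simp [h, h2]
    · simp [h]

theorem inner_spaceProj_left (P : Set (EuclideanSpace ℝ (Fin N))) (f g : L2Space N) :
    ⟪spaceProj P f, g⟫_ℂ = ⟪f, spaceProj P g⟫_ℂ :=
  Submodule.inner_starProjection_left_eq_right _ f g

theorem inner_bandProj_left (Q : Set (EuclideanSpace ℝ (Fin N))) (f g : L2Space N) :
    ⟪bandProj Q f, g⟫_ℂ = ⟪f, bandProj Q g⟫_ℂ :=
  Submodule.inner_starProjection_left_eq_right _ f g

/-- As `T` is self-adjoint this is `tr T²`. For `x ∈ P` the representing vector is `y ↦ 1_P(y) k_R(y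
- x)`, obtained by moving the projection and the Fourier transform across the inner product. -/
theorem tsum_enorm_limitingOperator {P Q : Set (EuclideanSpace ℝ (Fin N))}
    (hP : MeasurableSet P)
    (hQ : MeasurableSet {ξ : EuclideanSpace ℝ (Fin N) | (2 * Real.pi) • ξ ∈ Q})
    (hQfin : volume {ξ : EuclideanSpace ℝ (Fin N) | (2 * Real.pi) • ξ ∈ Q} ≠ ∞)
    {ι : Type*} (b : HilbertBasis ι ℂ (L2Space N)) :
    ∑' i, ‖limitingOperator P Q (b i)‖ₑ ^ 2 =
      ∫⁻ x in P, ∫⁻ y in P,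
        ‖bandKernel {ξ : EuclideanSpace ℝ (Fin N) | (2 * Real.pi) • ξ ∈ Q} (y - x)‖ₑ ^ 2 := by
  set R := {ξ : EuclideanSpace ℝ (Fin N) | (2 * Real.pi) • ξ ∈ Q} with hR
  rw [tsum_enorm_sq_eq_lintegral b (fun f => limitingOperator P Q f)
    (P.indicator fun x => spaceProj P (𝓕⁻ (cutExp R hQ hQfin (-x))))]
  · rw [← lintegral_indicator hP]
    refine lintegral_congr fun x => ?_
    by_cases h : x ∈ P
    · rw [Set.indicator_of_mem h, Set.indicator_of_mem h, L2Space_enorm_sq,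
        ← lintegral_indicator hP]
      refine lintegral_congr_ae ?_
      filter_upwards [spaceProj_ae_eq hP (𝓕⁻ (cutExp R hQ hQfin (-x))),
        fourierInv_cutExp_ae_eq hQ hQfin (-x)] with y h1 h2
      rw [h1]
      by_cases hy : y ∈ P
      · simp [hy, h2, neg_add_eq_sub]
      · simp [hy]
    · simp [h]
  · intro f
    have e : limitingOperator P Q f =
        spaceProj P (𝓕⁻ (spaceProj R (𝓕 (spaceProj P f)))) := by
      rw [← bandProj_eq]; rfl
    rw [e]
    filter_upwards [spaceProj_ae_eq hP (𝓕⁻ (spaceProj R (𝓕 (spaceProj P f)))),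
      fourierInv_spaceProj_ae_eq hQ hQfin (𝓕 (spaceProj P f))] with x h1 h2
    rw [h1]
    by_cases h : x ∈ P
    · rw [Set.indicator_of_mem h, Set.indicator_of_mem h, h2, inner_spaceProj_left,
        ← Lp.inner_fourier_eq (𝓕⁻ _), FourierTransform.fourier_fourierInv_eq]
    · simp [h]

/-! ### Linear changes of variables. -/

theorem det_toEuclideanLin (A : Matrix (Fin N) (Fin N) ℝ) :
    LinearMap.det A.toEuclideanLin = A.det := by
  change LinearMap.det (Matrix.toLpLin 2 2 A) = A.det
  rw [Matrix.toLpLin_eq_toLin, LinearMap.det_toLin]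

theorem toEuclideanLin_mul_apply (A B : Matrix (Fin N) (Fin N) ℝ)
    (x : EuclideanSpace ℝ (Fin N)) :
    (A * B).toEuclideanLin x = A.toEuclideanLin (B.toEuclideanLin x) := by
  simp [Matrix.toLpLin_apply, Matrix.mulVec_mulVec]

theorem inner_toEuclideanLin_left (B : Matrix (Fin N) (Fin N) ℝ)
    (x y : EuclideanSpace ℝ (Fin N)) :
    inner ℝ (B.toEuclideanLin x) y = inner ℝ x (B.transpose.toEuclideanLin y) := by
  have h := Matrix.toEuclideanLin_conjTranspose_eq_adjoint B
  rw [Matrix.conjTranspose_eq_transpose_of_trivial] at h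
  rw [h, LinearMap.adjoint_inner_right]

theorem toEuclideanLin_injective {A : Matrix (Fin N) (Fin N) ℝ} (hA : A.det ≠ 0) :
    Function.Injective A.toEuclideanLin := by
  intro x y h
  have := congrArg (A⁻¹).toEuclideanLin h
  rw [← toEuclideanLin_mul_apply, ← toEuclideanLin_mul_apply,
    Matrix.nonsing_inv_mul A (isUnit_iff_ne_zero.2 hA)] at this
  simpa [Matrix.toLpLin_apply] using this

theorem toEuclideanLin_apply_inv {A : Matrix (Fin N) (Fin N) ℝ} (hA : A.det ≠ 0)
    (x : EuclideanSpace ℝ (Fin N)) : A.toEuclideanLin ((A⁻¹).toEuclideanLin x) = x := by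
  rw [← toEuclideanLin_mul_apply, Matrix.mul_nonsing_inv A (isUnit_iff_ne_zero.2 hA)]
  simp

theorem toEuclideanLin_inv_apply {A : Matrix (Fin N) (Fin N) ℝ} (hA : A.det ≠ 0)
    (x : EuclideanSpace ℝ (Fin N)) : (A⁻¹).toEuclideanLin (A.toEuclideanLin x) = x := by
  rw [← toEuclideanLin_mul_apply, Matrix.nonsing_inv_mul A (isUnit_iff_ne_zero.2 hA)]
  simp

theorem volume_matImage (A : Matrix (Fin N) (Fin N) ℝ) (P : Set (EuclideanSpace ℝ (Fin N))) :
    volume (matImage A P) = ENNReal.ofReal |A.det| * volume P := by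
  rw [matImage, Measure.addHaar_image_linearMap, det_toEuclideanLin]

theorem measurableSet_matImage {A : Matrix (Fin N) (Fin N) ℝ} (hA : A.det ≠ 0)
    {P : Set (EuclideanSpace ℝ (Fin N))} (hP : MeasurableSet P) :
    MeasurableSet (matImage A P) :=
  hP.image_of_continuousOn_injOn (LinearMap.continuous_of_finiteDimensional _).continuousOn
    (toEuclideanLin_injective hA).injOn

theorem lintegral_matImage {A : Matrix (Fin N) (Fin N) ℝ} (hA : A.det ≠ 0)
    {P : Set (EuclideanSpace ℝ (Fin N))} (hP : MeasurableSet P)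
    (g : EuclideanSpace ℝ (Fin N) → ℝ≥0∞) :
    ∫⁻ x in matImage A P, g x = ENNReal.ofReal |A.det| * ∫⁻ x in P, g (A.toEuclideanLin x) := by
  rw [← lintegral_const_mul' _ _ ENNReal.ofReal_ne_top]
  have := lintegral_image_eq_lintegral_abs_det_fderiv_mul volume hP
    (f := A.toEuclideanLin) (f' := fun _ => A.toEuclideanLin.toContinuousLinearMap)
    (fun x _ => A.toEuclideanLin.toContinuousLinearMap.hasFDerivWithinAt)
    (toEuclideanLin_injective hA).injOn g
  rw [matImage, this]
  simp only [ContinuousLinearMap.det, LinearMap.coe_toContinuousLinearMap, det_toEuclideanLin]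

theorem bandKernel_matImage {B : Matrix (Fin N) (Fin N) ℝ} (hB : B.det ≠ 0)
    {R : Set (EuclideanSpace ℝ (Fin N))} (hR : MeasurableSet R) (x : EuclideanSpace ℝ (Fin N)) :
    bandKernel (matImage B R) x = |B.det| • bandKernel R (B.transpose.toEuclideanLin x) := by
  have := integral_image_eq_integral_abs_det_fderiv_smul volume hR
    (f := B.toEuclideanLin) (f' := fun _ => B.toEuclideanLin.toContinuousLinearMap)
    (fun x _ => B.toEuclideanLin.toContinuousLinearMap.hasFDerivWithinAt)
    (toEuclideanLin_injective hB).injOn (fun ξ => (Real.fourierChar (inner ℝ ξ x) : ℂ))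
  rw [bandKernel, matImage, this, bandKernel, ← integral_smul]
  simp only [ContinuousLinearMap.det, LinearMap.coe_toContinuousLinearMap, det_toEuclideanLin,
    inner_toEuclideanLin_left]

theorem measurable_bandKernel (R : Set (EuclideanSpace ℝ (Fin N))) :
    Measurable (bandKernel R) := by
  have h : Continuous fun p : EuclideanSpace ℝ (Fin N) × EuclideanSpace ℝ (Fin N) =>
      (Real.fourierChar (inner ℝ p.2 p.1) : ℂ) :=
    continuous_subtype_val.comp (Real.continuous_fourierChar.comp (by fun_prop))
  exact (h.stronglyMeasurable.integral_prod_right' (ν := volume.restrict R)).measurable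

theorem setOf_two_pi_smul_mem_matImage (B : Matrix (Fin N) (Fin N) ℝ)
    (Q : Set (EuclideanSpace ℝ (Fin N))) :
    {ξ : EuclideanSpace ℝ (Fin N) | (2 * Real.pi) • ξ ∈ matImage B Q} =
      matImage B {ξ | (2 * Real.pi) • ξ ∈ Q} := by
  have h2 : (2 * Real.pi) ≠ 0 := by positivity
  ext ξ
  constructor
  · rintro ⟨x, hx, h⟩
    refine ⟨(2 * Real.pi)⁻¹ • x, ?_, ?_⟩
    · change (2 * Real.pi) • (2 * Real.pi)⁻¹ • x ∈ Q
      rwa [smul_inv_smul₀ h2]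
    · rw [map_smul, h, inv_smul_smul₀ h2]
  · rintro ⟨x, hx, rfl⟩
    exact ⟨(2 * Real.pi) • x, hx, map_smul _ _ _⟩

theorem volume_setOf_two_pi_smul_mem (Q : Set (EuclideanSpace ℝ (Fin N))) :
    volume {ξ : EuclideanSpace ℝ (Fin N) | (2 * Real.pi) • ξ ∈ Q} =
      ENNReal.ofReal ((2 * Real.pi) ^ N)⁻¹ * volume Q := by
  have h := Measure.addHaar_preimage_smul (volume : Measure (EuclideanSpace ℝ (Fin N)))
    (show (2 * Real.pi) ≠ 0 by positivity) Q
  rw [finrank_euclideanSpace_fin, abs_of_nonneg (by positivity)] at h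
  exact h

/-! ### The overlap integral and its limit. -/

/-- The integrand `1_P(x + D z) |k_R(z)|²`. -/
def overlapIntegrand (P R : Set (EuclideanSpace ℝ (Fin N))) (D : Matrix (Fin N) (Fin N) ℝ)
    (x z : EuclideanSpace ℝ (Fin N)) : ℝ≥0∞ :=
  P.indicator (fun _ => 1) (D.toEuclideanLin z + x) * ‖bandKernel R z‖ₑ ^ 2

/-- The overlap integral `∫_P ∫ 1_P(x + D z) |k_R(z)|² dz dx`. -/
def overlapIntegral (P R : Set (EuclideanSpace ℝ (Fin N))) (D : Matrix (Fin N) (Fin N) ℝ) :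
    ℝ≥0∞ :=
  ∫⁻ x in P, ∫⁻ z, overlapIntegrand P R D x z

/-- Pulling `x` and `y` back by `A` gives `|det A|²`, and the kernel of `B R` contributes `|det
B|²`. The substitution `z = Bᵀ A (y - x)` takes back one factor `|det A| |det B|`. -/
theorem lintegral_bandKernel_matImage {A B : Matrix (Fin N) (Fin N) ℝ} (hA : A.det ≠ 0)
    (hB : B.det ≠ 0) {P R : Set (EuclideanSpace ℝ (Fin N))} (hP : MeasurableSet P)
    (hR : MeasurableSet R) :
    ∫⁻ x in matImage A P, ∫⁻ y in matImage A P, ‖bandKernel (matImage B R) (y - x)‖ₑ ^ 2 =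
      ENNReal.ofReal (|A.det| * |B.det|) * overlapIntegral P R (B.transpose * A)⁻¹ := by
  set M := B.transpose * A with hM
  have hMdet : M.det = B.det * A.det := by rw [hM, Matrix.det_mul, Matrix.det_transpose]
  have hM0 : M.det ≠ 0 := by rw [hMdet]; exact mul_ne_zero hB hA
  have hMabs : ENNReal.ofReal |M.det| = ENNReal.ofReal |A.det| * ENNReal.ofReal |B.det| := by
    rw [hMdet, abs_mul, ENNReal.ofReal_mul (abs_nonneg _), mul_comm]
  have hk : ∀ z, ‖bandKernel (matImage B R) (A.toEuclideanLin z)‖ₑ ^ 2 =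
      ENNReal.ofReal |B.det| ^ 2 * ‖bandKernel R (M.toEuclideanLin z)‖ₑ ^ 2 := by
    intro z
    rw [bandKernel_matImage hB hR, enorm_smul, mul_pow, ← toEuclideanLin_mul_apply,
      Real.enorm_abs, ← Real.enorm_abs, Real.enorm_of_nonneg (abs_nonneg _)]
  have hinner : ∀ x, ENNReal.ofReal |M.det| *
      ∫⁻ y in P, ‖bandKernel R (M.toEuclideanLin (y - x))‖ₑ ^ 2 =
        ∫⁻ z, overlapIntegrand P R M⁻¹ x z := by
    intro x
    -- Surjectivity of `M` lets the change of variables run over the whole space.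
    have huniv : matImage M Set.univ = Set.univ :=
      Set.eq_univ_of_forall fun z =>
        ⟨(M⁻¹).toEuclideanLin z, trivial, toEuclideanLin_apply_inv hM0 z⟩
    have h1 := lintegral_matImage hM0 MeasurableSet.univ (fun z =>
      overlapIntegrand P R M⁻¹ x z)
    rw [huniv, setLIntegral_univ, setLIntegral_univ] at h1
    rw [h1]
    congr 1
    rw [← lintegral_indicator hP, ← lintegral_add_right_eq_self _ x]
    refine lintegral_congr fun y => ?_
    rw [overlapIntegrand, toEuclideanLin_inv_apply hM0]
    by_cases h : y + x ∈ P
    · simp [h]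
    · simp [h]
  rw [lintegral_matImage hA hP, overlapIntegral]
  have hstep : ∀ x, ∫⁻ y in matImage A P,
      ‖bandKernel (matImage B R) (y - A.toEuclideanLin x)‖ₑ ^ 2 =
      ENNReal.ofReal |B.det| * ∫⁻ z, overlapIntegrand P R M⁻¹ x z := by
    intro x
    rw [lintegral_matImage hA hP, ← hinner x, hMabs]
    simp_rw [← map_sub, hk]
    rw [lintegral_const_mul' _ _ (by finiteness)]
    ring
  simp_rw [hstep]
  rw [lintegral_const_mul' _ _ ENNReal.ofReal_ne_top, ← mul_assoc,
    ENNReal.ofReal_mul (abs_nonneg _)]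

theorem measurable_overlapIntegrand {P : Set (EuclideanSpace ℝ (Fin N))} (hP : MeasurableSet P)
    (R : Set (EuclideanSpace ℝ (Fin N))) (D : Matrix (Fin N) (Fin N) ℝ) :
    Measurable (Function.uncurry (overlapIntegrand P R D)) := by
  have hD : Continuous D.toEuclideanLin := LinearMap.continuous_of_finiteDimensional _
  have h1 : Measurable fun p : EuclideanSpace ℝ (Fin N) × EuclideanSpace ℝ (Fin N) =>
      D.toEuclideanLin p.2 + p.1 :=
    ((hD.comp continuous_snd).add continuous_fst).measurable
  have h2 : Measurable (P.indicator fun _ => (1 : ℝ≥0∞)) := measurable_const.indicator hP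
  have h3 : Measurable fun z => ‖bandKernel R z‖ₑ ^ 2 :=
    (measurable_bandKernel R).enorm.pow_const 2
  exact (h2.comp h1).mul (h3.comp measurable_snd)

theorem overlapIntegrand_le (P R : Set (EuclideanSpace ℝ (Fin N)))
    (D : Matrix (Fin N) (Fin N) ℝ) (x z : EuclideanSpace ℝ (Fin N)) :
    overlapIntegrand P R D x z ≤ ‖bandKernel R z‖ₑ ^ 2 :=
  mul_le_of_le_one_left' (Set.indicator_le_self' (fun _ _ => zero_le) _)

/-- Since `P` is open, `D z + x` stays in `P` for `D` near `0`, so the integrand is eventually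
constant. -/
theorem tendsto_overlapIntegrand {P : Set (EuclideanSpace ℝ (Fin N))} (hP : IsOpen P)
    (R : Set (EuclideanSpace ℝ (Fin N))) {x : EuclideanSpace ℝ (Fin N)} (hx : x ∈ P)
    (z : EuclideanSpace ℝ (Fin N)) :
    Tendsto (fun D => overlapIntegrand P R D x z) (𝓝 0) (𝓝 (‖bandKernel R z‖ₑ ^ 2)) := by
  have hD : Tendsto (fun D : Matrix (Fin N) (Fin N) ℝ => D.toEuclideanLin z + x) (𝓝 0)
      (𝓝 x) := by
    have hc : Continuous fun D : Matrix (Fin N) (Fin N) ℝ => D.toEuclideanLin z + x := by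
      simp only [Matrix.toLpLin_apply]
      fun_prop
    have := hc.tendsto 0
    simpa using this
  refine tendsto_const_nhds.congr' ?_
  filter_upwards [hD.eventually (hP.mem_nhds hx)] with D h
  rw [overlapIntegrand, Set.indicator_of_mem h, one_mul]

theorem tendsto_overlapIntegral {P R : Set (EuclideanSpace ℝ (Fin N))} (hP : IsOpen P)
    (hPfin : volume P ≠ ∞) (hR : MeasurableSet R) (hRfin : volume R ≠ ∞) :
    Tendsto (overlapIntegral P R) (𝓝 0) (𝓝 (volume P * volume R)) := by
  -- Dominated convergence along `𝓝 0` requires a countably generated filter.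
  have : FirstCountableTopology (Matrix (Fin N) (Fin N) ℝ) :=
    inferInstanceAs (FirstCountableTopology (Fin N → Fin N → ℝ))
  have hmeas := measurable_overlapIntegrand hP.measurableSet R
  have hint := lintegral_enorm_bandKernel_sq hR hRfin
  have hinner : ∀ x ∈ P, Tendsto (fun D => ∫⁻ z, overlapIntegrand P R D x z)
      (𝓝 0) (𝓝 (volume R)) := by
    intro x hx
    rw [← hint]
    refine tendsto_lintegral_filter_of_dominated_convergence (fun z => ‖bandKernel R z‖ₑ ^ 2)
      (Eventually.of_forall fun D => (hmeas D).of_uncurry_left)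
      (Eventually.of_forall fun D => ae_of_all _ fun z => overlapIntegrand_le P R D x z) ?_
      (ae_of_all _ fun z => tendsto_overlapIntegrand hP R hx z)
    rw [hint]; exact hRfin
  -- Second dominated convergence: the inner integral is at most `volume R`, a constant integrable
  -- over `P`.
  have hmain : Tendsto (overlapIntegral P R) (𝓝 0) (𝓝 (∫⁻ _ in P, volume R)) := by
    refine tendsto_lintegral_filter_of_dominated_convergence (fun _ => volume R)
      (Eventually.of_forall fun D => (hmeas D).lintegral_prod_right')
      (Eventually.of_forall fun D => ae_of_all _ fun x => ?_) ?_ ?_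
    · rw [← hint]
      exact lintegral_mono fun z => overlapIntegrand_le P R D x z
    · rw [setLIntegral_const]; exact ENNReal.mul_ne_top hRfin hPfin
    · rw [ae_restrict_iff' hP.measurableSet]
      exact ae_of_all _ hinner
  rwa [setLIntegral_const, mul_comm] at hmain

/-- Only `N` points are tested for each `r`: if `M y_i = r⁻¹ e_i` with `‖y_i‖ < 1`, then the vectors
`r y_i` are the columns of `M⁻¹`, whose entries are therefore smaller than `r`. -/
theorem tendsto_inv_of_eventually_mem_matImage_ball {α : Type*} {l : Filter α}
    {M : α → Matrix (Fin N) (Fin N) ℝ}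
    (h : ∀ x : EuclideanSpace ℝ (Fin N), ∀ᶠ p in l, x ∈ matImage (M p) (Metric.ball 0 1)) :
    (∀ᶠ p in l, (M p).det ≠ 0) ∧ Tendsto (fun p => (M p)⁻¹) l (𝓝 0) := by
  have key : ∀ r : ℝ, 0 < r → ∀ᶠ p in l, (M p).det ≠ 0 ∧ ∀ j i, |(M p)⁻¹ j i| < r := by
    intro r hr
    have h1 : ∀ᶠ p in l, ∀ i : Fin N,
        (EuclideanSpace.single i r⁻¹ : EuclideanSpace ℝ (Fin N)) ∈
          matImage (M p) (Metric.ball 0 1) := eventually_all.2 fun i => h _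
    filter_upwards [h1] with p hp
    choose y hy hMy using hp
    have hinv : M p * Matrix.of (fun j i => r * y i j) = 1 := by
      ext k i
      have h2 : (M p).mulVec (y i) k = (EuclideanSpace.single i r⁻¹ : EuclideanSpace ℝ (Fin N)) k := by
        rw [← hMy i]; simp [Matrix.toLpLin_apply]
      rw [Matrix.mul_apply]
      simp only [Matrix.of_apply]
      have h3 : ∑ j, M p k j * (r * y i j) = r * (M p).mulVec (y i) k := by
        rw [Matrix.mulVec, dotProduct, Finset.mul_sum]
        exact Finset.sum_congr rfl fun j _ => by ring
      rw [h3, h2, Matrix.one_apply]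
      by_cases hki : k = i
      · simp [hki, hr.ne']
      · simp [hki]
    refine ⟨?_, fun j i => ?_⟩
    · intro h0
      have := congrArg Matrix.det hinv
      rw [Matrix.det_mul, h0, zero_mul, Matrix.det_one] at this
      exact zero_ne_one this
    · rw [Matrix.inv_eq_right_inv hinv, Matrix.of_apply, abs_mul, abs_of_pos hr]
      have h4 : ‖y i‖ < 1 := by simpa using hy i
      have h5 : |y i j| < 1 := (PiLp.norm_apply_le (y i) j).trans_lt h4
      exact mul_lt_of_lt_one_right hr h5
  refine ⟨(key 1 one_pos).mono fun p hp => hp.1, ?_⟩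
  refine tendsto_pi_nhds.2 fun j => tendsto_pi_nhds.2 fun i => ?_
  rw [Metric.tendsto_nhds]
  intro r hr
  filter_upwards [key r hr] with p hp
  simpa using hp.2 j i

/-! ### Passing to interiors. -/

theorem spaceLimited_congr {P P' : Set (EuclideanSpace ℝ (Fin N))} (h : P =ᵐ[volume] P') :
    spaceLimited P = spaceLimited P' := by
  ext f
  rw [mem_spaceLimited, mem_spaceLimited]
  refine eventually_congr ?_
  filter_upwards [h.mem_iff] with x hx
  rw [hx]

theorem spaceProj_congr {P P' : Set (EuclideanSpace ℝ (Fin N))} (h : P =ᵐ[volume] P') :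
    spaceProj P = spaceProj P' := by
  unfold spaceProj
  congr 1
  exact spaceLimited_congr h

theorem bandProj_congr {Q Q' : Set (EuclideanSpace ℝ (Fin N))} (h :
    {ξ : EuclideanSpace ℝ (Fin N) | (2 * Real.pi) • ξ ∈ Q} =ᵐ[volume]
      {ξ : EuclideanSpace ℝ (Fin N) | (2 * Real.pi) • ξ ∈ Q'}) :
    bandProj Q = bandProj Q' := by
  ext1 f
  rw [bandProj_eq, bandProj_eq, spaceProj_congr h]

/-- A linear map sends null sets to null sets, and `A P \ A P'` lies in `A (P \ P')` even for
singular `A`. -/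
theorem matImage_ae_eq (A : Matrix (Fin N) (Fin N) ℝ) {P P' : Set (EuclideanSpace ℝ (Fin N))}
    (hsub : P' ⊆ P) (h : volume (P \ P') = 0) : matImage A P =ᵐ[volume] matImage A P' := by
  refine Filter.EventuallyLE.antisymm (ae_le_set.2 ?_)
    (Set.image_mono hsub).eventuallyLE
  have himage : matImage A P \ matImage A P' ⊆ matImage A (P \ P') := by
    rintro _ ⟨⟨x, hx, rfl⟩, hx'⟩
    exact ⟨x, ⟨hx, fun h => hx' ⟨x, h, rfl⟩⟩, rfl⟩
  refine measure_mono_null himage ?_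
  have := volume_matImage A (P \ P')
  rwa [h, mul_zero] at this

theorem volume_diff_interior {P : Set (EuclideanSpace ℝ (Fin N))}
    (hP0 : volume (frontier P) = 0) : volume (P \ interior P) = 0 :=
  measure_mono_null (Set.sdiff_subset_sdiff_left subset_closure) hP0

theorem volume_interior_eq {P : Set (EuclideanSpace ℝ (Fin N))}
    (hP0 : volume (frontier P) = 0) : volume (interior P) = volume P :=
  measure_eq_measure_of_null_sdiff interior_subset (volume_diff_interior hP0)

theorem limitingOperator_matImage_interior (A B : Matrix (Fin N) (Fin N) ℝ)
    {P Q : Set (EuclideanSpace ℝ (Fin N))} (hP0 : volume (frontier P) = 0)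
    (hQ0 : volume (frontier Q) = 0) :
    limitingOperator (matImage A P) (matImage B Q) =
      limitingOperator (matImage A (interior P)) (matImage B (interior Q)) := by
  have h1 := spaceProj_congr (matImage_ae_eq A interior_subset (volume_diff_interior hP0))
  have h2 : bandProj (matImage B Q) = bandProj (matImage B (interior Q)) := by
    apply bandProj_congr
    rw [setOf_two_pi_smul_mem_matImage, setOf_two_pi_smul_mem_matImage]
    refine matImage_ae_eq B (fun ξ hξ => interior_subset (s := Q) hξ) ?_
    have h3 := volume_setOf_two_pi_smul_mem (Q \ interior Q)
    rwa [volume_diff_interior hQ0, mul_zero] at h3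
  rw [limitingOperator, limitingOperator, h1, h2]

/-! ### Normalised bounds and the limit. -/

theorem enorm_spaceProj_le (P : Set (EuclideanSpace ℝ (Fin N))) (f : L2Space N) :
    ‖spaceProj P f‖ₑ ≤ ‖f‖ₑ := by
  rw [← ofReal_norm, ← ofReal_norm]
  exact ENNReal.ofReal_le_ofReal (Submodule.norm_starProjection_apply_le (spaceLimited P) f)

theorem limitingOperator_isSymmetric (P Q : Set (EuclideanSpace ℝ (Fin N))) :
    (limitingOperator P Q).toLinearMap.IsSymmetric := by
  intro f g
  change ⟪spaceProj P (bandProj Q (spaceProj P f)), g⟫_ℂ =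
    ⟪f, spaceProj P (bandProj Q (spaceProj P g))⟫_ℂ
  rw [inner_spaceProj_left, inner_bandProj_left, inner_spaceProj_left]

theorem bandProj_bandProj (Q : Set (EuclideanSpace ℝ (Fin N))) (f : L2Space N) :
    bandProj Q (bandProj Q f) = bandProj Q f :=
  Submodule.starProjection_eq_self_iff.2 (Submodule.starProjection_apply_mem (bandLimited Q) f)

theorem inner_limitingOperator (P Q : Set (EuclideanSpace ℝ (Fin N))) (f : L2Space N) :
    ⟪f, limitingOperator P Q f⟫_ℂ = ((‖(bandProj Q ∘L spaceProj P) f‖ ^ 2 : ℝ) : ℂ) := by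
  change ⟪f, spaceProj P (bandProj Q (spaceProj P f))⟫_ℂ =
    ((‖bandProj Q (spaceProj P f)‖ ^ 2 : ℝ) : ℂ)
  rw [← inner_spaceProj_left, ← bandProj_bandProj, ← inner_bandProj_left,
    inner_self_eq_norm_sq_to_K, bandProj_bandProj]
  norm_cast

theorem norm_bandProj_comp_spaceProj_le (P Q : Set (EuclideanSpace ℝ (Fin N))) :
    ‖bandProj Q ∘L spaceProj P‖ ≤ 1 :=
  (ContinuousLinearMap.opNorm_comp_le _ _).trans
    (mul_le_one₀ (Submodule.starProjection_norm_le (bandLimited Q)) (norm_nonneg _)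
      (Submodule.starProjection_norm_le (spaceLimited P)))

/-- Here `tr T = d L` and `tr T² = d G`, so the bounds of `eigenvalueCount_bounds` are homogeneous
in `d = |det A| |det B|`, which is neither `0` nor `∞` and cancels. -/
theorem eigenvalueCount_limitingOperator_bounds {A B : Matrix (Fin N) (Fin N) ℝ}
    (hA : A.det ≠ 0) (hB : B.det ≠ 0) {P Q : Set (EuclideanSpace ℝ (Fin N))}
    (hP : MeasurableSet P) (hPfin : volume P ≠ ∞)
    (hQ : MeasurableSet {ξ : EuclideanSpace ℝ (Fin N) | (2 * Real.pi) • ξ ∈ Q})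
    (hQfin : volume {ξ : EuclideanSpace ℝ (Fin N) | (2 * Real.pi) • ξ ∈ Q} ≠ ∞)
    {ε : ℝ} (hε0 : 0 < ε) (hε1 : ε < 1) {L G n C : ℝ≥0∞}
    (hL : L = volume P * volume {ξ : EuclideanSpace ℝ (Fin N) | (2 * Real.pi) • ξ ∈ Q})
    (hG : G = overlapIntegral P {ξ | (2 * Real.pi) • ξ ∈ Q} (B.transpose * A)⁻¹)
    (hn : n = eigenvalueCount (limitingOperator (matImage A P) (matImage B Q)).toLinearMap ε /
      ENNReal.ofReal (|A.det| * |B.det|))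
    (hC : C = ENNReal.ofReal (ε⁻¹ + (1 - ε)⁻¹)) :
    n ≤ L + C * (L - G) ∧ L ≤ n + C * (L - G) := by
  set R := {ξ : EuclideanSpace ℝ (Fin N) | (2 * Real.pi) • ξ ∈ Q} with hRdef
  set d := ENNReal.ofReal (|A.det| * |B.det|) with hd
  have hd0 : d ≠ 0 := by
    rw [hd, ne_eq, ENNReal.ofReal_eq_zero, not_le]
    positivity
  have hdtop : d ≠ ∞ := ENNReal.ofReal_ne_top
  have hAP := measurableSet_matImage hA hP
  have hAPfin : volume (matImage A P) ≠ ∞ := by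
    rw [volume_matImage]; finiteness
  have hBR := measurableSet_matImage hB hQ
  have hBRfin : volume (matImage B R) ≠ ∞ := by
    rw [volume_matImage]; finiteness
  rw [← setOf_two_pi_smul_mem_matImage] at hBR hBRfin
  have ht : ∀ {ι : Type} (b : HilbertBasis ι ℂ (L2Space N)),
      ∑' i, ‖(bandProj (matImage B Q) ∘L spaceProj (matImage A P)) (b i)‖ₑ ^ 2 = d * L := by
    intro ι b
    have := tsum_enorm_bandProj_spaceProj hAP hAPfin hBR b
    rw [setOf_two_pi_smul_mem_matImage, volume_matImage, volume_matImage] at this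
    refine Eq.trans this ?_
    rw [hd, hL, ENNReal.ofReal_mul (abs_nonneg _)]
    ring
  have hs : ∀ {ι : Type} (b : HilbertBasis ι ℂ (L2Space N)),
      ∑' i, ‖limitingOperator (matImage A P) (matImage B Q) (b i)‖ₑ ^ 2 = d * G := by
    intro ι b
    rw [tsum_enorm_limitingOperator hAP hBR hBRfin b, setOf_two_pi_smul_mem_matImage,
      lintegral_bandKernel_matImage hA hB hP hQ, hG]
  -- `T` is `K` followed by a projection, hence `‖T b_i‖ ≤ ‖K b_i‖` for each basis vector.
  have hst : d * G ≤ d * L := by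
    obtain ⟨w, b, -⟩ := exists_hilbertBasis ℂ (L2Space N)
    rw [← hs b, ← ht b]
    exact ENNReal.tsum_le_tsum fun i => pow_le_pow_left' (enorm_spaceProj_le _ _) 2
  have hLtop : L ≠ ∞ := by rw [hL]; exact ENNReal.mul_ne_top hPfin hQfin
  obtain ⟨h1, h2⟩ := eigenvalueCount_bounds (norm_bandProj_comp_spaceProj_le _ _)
    (limitingOperator_isSymmetric _ _) (inner_limitingOperator _ _) ht hs
    (ENNReal.mul_ne_top hdtop hLtop) hst hε0 hε1
  have hdn : eigenvalueCount (limitingOperator (matImage A P) (matImage B Q)).toLinearMap ε =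
      d * n := by rw [hn, ENNReal.mul_div_cancel hd0 hdtop]
  rw [hdn, ← hC, ← ENNReal.mul_sub (fun _ _ => hdtop), mul_left_comm, ← mul_add] at h1 h2
  exact ⟨(ENNReal.mul_le_mul_iff_right hd0 hdtop).1 h1,
    (ENNReal.mul_le_mul_iff_right hd0 hdtop).1 h2⟩

end

/-- The sets `Bᵀ A U`, with `U` the unit ball, exhaust `ℝᴺ` along `l`: every point of `ℝᴺ`
eventually belongs to them. The filter `l` expresses the limit `(τ, ρ) → (τ₀, ρ₀)`; it is
arbitrary, so that the limit point may be finite or infinite, and the parameters may be real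
numbers, several numbers, or absent. -/
theorem theorem3 {N : ℕ} (P Q : Set (EuclideanSpace ℝ (Fin N)))
    (hP : NullMeasurableSet P volume) (hQ : NullMeasurableSet Q volume)
    (hPfin : volume P ≠ ∞) (hQfin : volume Q ≠ ∞)
    (hP0 : volume (frontier P) = 0) (hQ0 : volume (frontier Q) = 0)
    {ι κ : Type*} (A : ι → Matrix (Fin N) (Fin N) ℝ) (B : κ → Matrix (Fin N) (Fin N) ℝ)
    (l : Filter (ι × κ))
    (hlim : ∀ x : EuclideanSpace ℝ (Fin N), ∀ᶠ p in l,
      x ∈ matImage ((B p.2).transpose * A p.1) (Metric.ball 0 1))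
    (ε : ℝ) (hε0 : 0 < ε) (hε1 : ε < 1) :
    Tendsto
      (fun p : ι × κ =>
        eigenvalueCount
            (limitingOperator (matImage (A p.1) P) (matImage (B p.2) Q)).toLinearMap ε /
          ENNReal.ofReal (|(A p.1).det| * |(B p.2).det|))
      l (𝓝 (ENNReal.ofReal ((2 * Real.pi) ^ N)⁻¹ * volume P * volume Q)) := by
  set PI := interior P with hPI
  set QI := interior Q with hQI
  set R := {ξ : EuclideanSpace ℝ (Fin N) | (2 * Real.pi) • ξ ∈ QI} with hR
  have hRmeas : MeasurableSet R :=
    (isOpen_interior.preimage (continuous_const_smul (2 * Real.pi))).measurableSet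
  have hPIfin : volume PI ≠ ∞ := by rwa [hPI, volume_interior_eq hP0]
  have hRvol : volume R = ENNReal.ofReal ((2 * Real.pi) ^ N)⁻¹ * volume Q := by
    rw [hR, volume_setOf_two_pi_smul_mem, volume_interior_eq hQ0]
  have hRfin : volume R ≠ ∞ := by
    rw [hRvol]; exact ENNReal.mul_ne_top ENNReal.ofReal_ne_top hQfin
  obtain ⟨hdet, hinv⟩ := tendsto_inv_of_eventually_mem_matImage_ball
    (M := fun p : ι × κ => (B p.2).transpose * A p.1) hlim
  have hG := (tendsto_overlapIntegral isOpen_interior hPIfin hRmeas hRfin).comp hinv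
  have hgoal : ENNReal.ofReal ((2 * Real.pi) ^ N)⁻¹ * volume P * volume Q =
      volume PI * volume R := by
    rw [hRvol, hPI, volume_interior_eq hP0]; ring
  rw [hgoal]
  set L := volume PI * volume R with hL
  have hLtop : L ≠ ∞ := ENNReal.mul_ne_top hPIfin hRfin
  set C := ENNReal.ofReal (ε⁻¹ + (1 - ε)⁻¹) with hC
  set G := fun p : ι × κ => overlapIntegral PI R ((B p.2).transpose * A p.1)⁻¹ with hGdef
  have herr : Tendsto (fun p => C * (L - G p)) l (𝓝 0) := by
    have h1 : Tendsto (fun p => L - G p) l (𝓝 (L - L)) :=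
      ENNReal.Tendsto.sub tendsto_const_nhds hG (Or.inl hLtop)
    have h2 := ENNReal.Tendsto.const_mul (a := C) h1 (Or.inr ENNReal.ofReal_ne_top)
    simpa using h2
  have hbounds : ∀ᶠ p in l,
      eigenvalueCount (limitingOperator (matImage (A p.1) P) (matImage (B p.2) Q)).toLinearMap ε /
          ENNReal.ofReal (|(A p.1).det| * |(B p.2).det|) ≤ L + C * (L - G p) ∧
      L ≤ eigenvalueCount
          (limitingOperator (matImage (A p.1) P) (matImage (B p.2) Q)).toLinearMap ε /
          ENNReal.ofReal (|(A p.1).det| * |(B p.2).det|) + C * (L - G p) := by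
    filter_upwards [hdet] with p hp
    rw [Matrix.det_mul, Matrix.det_transpose] at hp
    rw [limitingOperator_matImage_interior _ _ hP0 hQ0]
    exact eigenvalueCount_limitingOperator_bounds (right_ne_zero_of_mul hp)
      (left_ne_zero_of_mul hp) isOpen_interior.measurableSet hPIfin hRmeas hRfin hε0 hε1
      rfl rfl rfl rfl
  -- Squeeze: with the error tending to `0`, the lower bound is used in subtracted form.
  have hlow : Tendsto (fun p => L - C * (L - G p)) l (𝓝 L) := by
    have := ENNReal.Tendsto.sub (tendsto_const_nhds (x := L)) herr (Or.inl hLtop)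
    simpa using this
  have hupp : Tendsto (fun p => L + C * (L - G p)) l (𝓝 L) := by
    simpa using (tendsto_const_nhds (x := L)).add herr
  refine tendsto_of_tendsto_of_tendsto_of_le_of_le' hlow hupp ?_ ?_
  · filter_upwards [hbounds] with p hp
    exact tsub_le_iff_right.2 hp.2
  · filter_upwards [hbounds] with p hp
    exact hp.1
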